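/- Let $(X,m)$ be a Lebesgue space, that is, a standard Borel space with (the completion of) a Borel probability measure, and let a countable group $G$ act on $X$ by measure class preserving transformations (each $x\mapsto gx$ is $m$-measurable and $gm\sim m$). Suppose that the action is free, i.e. $m$-almost every point has trivial stabilizer. Measurability is understood with respect to the completed $\sigma$-algebra. A measurable set $A\subset X$ is \emph{recurrent} if for a.e. $x\in A$ there is $g\in G\setminus\{e\}$ with $gx\in A$, and \emph{wandering} if the translates $gA$, $g\in G$, are pairwise disjoint. A \emph{Hopf decomposition} is a decomposition $X=C\sqcup D$ into measurable $G$-invariant sets such that every measurable subset of $C$ is recurrent and $D$ is, up to a null set, the union of the translates of a wandering set contained in $D$; then $D$ is called the \emph{dissipative part} of the action. The \emph{ergodic component} of $x$ is given by the conditional probability measure $m_{\bar x}$ of $m$ with respect to the $\sigma$-algebra of (mod 0) $G$-invariant measurable sets, and the \emph{discontinual part} of the action is the union of its purely atomic ergodic components, i.e. the set of those $x$ for which $m_{\bar x}$ is purely atomic. For $x\in X$ let $\mu_x$ be the measure on the orbit $Gx$ given by $$\mu_x(gx)=\frac{d g^{-1}m}{dm}(x),\qquad g\in G,$$ where $g^{-1}m$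 is the image of $m$ under $g^{-1}$ (this is well defined for a.e. $x$, by freeness). \textbf{Theorem.} A Hopf decomposition exists, and, for any Hopf decomposition $X=C\sqcup D$, for $m$-a.e. $x\in X$ the following conditions are equivalent: (i) the orbit $Gx$ is dissipative, i.e. contained in the dissipative part $D$; (ii) the orbit $Gx$ is discontinual, i.e. contained in the discontinual part; (iii) the measure $\mu_x$ is finite; (iv) for every real $t>0$ the set $\{y\in Gx:\mu_x(y)\ge t\}$ is finite; (v) the set $M_x$ of the atoms of $\mu_x$ of maximal weight is non-empty and finite. -/

import Mathlib

open MeasureTheory ProbabilityTheory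
open scoped Pointwise ENNReal

/-- The action of `G` on `(X, m)` is by measure class preserving transformations. Measurability is
with respect to the `m`-completion of the `σ`-algebra of `X`, and `g m ≪ m` is required for every
`g` (hence also for `g⁻¹`, so that `g m` and `m` are equivalent). -/
structure MeasureClassPreservingAction (G : Type*) {X : Type*} [Group G] [MulAction G X]
    [MeasurableSpace X] (m : Measure X) : Prop where
  aemeasurable : ∀ g : G, AEMeasurable (fun x : X => g • x) m
  map_absolutelyContinuous : ∀ g : G, m.map (fun x : X => g • x) ≪ m

/-- The action is free (mod 0): almost every point has a trivial stabilizer. -/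
def FreeAction (G : Type*) {X : Type*} [Group G] [MulAction G X]
    [MeasurableSpace X] (m : Measure X) : Prop :=
  ∀ᵐ x ∂m, ∀ g : G, g • x = x → g = 1

/-- A recurrent set: almost every point of `A` returns to `A` under some `g ≠ 1`. -/
def IsRecurrentSet (G : Type*) {X : Type*} [Group G] [MulAction G X]
    [MeasurableSpace X] (m : Measure X) (A : Set X) : Prop :=
  NullMeasurableSet A m ∧ ∀ᵐ x ∂m, x ∈ A → ∃ g : G, g ≠ 1 ∧ g • x ∈ A

/-- A wandering set: a measurable set whose translates are pairwise disjoint. -/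
def IsWanderingSet (G : Type*) {X : Type*} [Group G] [MulAction G X]
    [MeasurableSpace X] (m : Measure X) (A : Set X) : Prop :=
  NullMeasurableSet A m ∧ ∀ g h : G, g ≠ h → Disjoint (g • A) (h • A)

/-- The restriction of the action to the invariant set `C` is conservative. -/
def ConservativeOn (G : Type*) {X : Type*} [Group G] [MulAction G X]
    [MeasurableSpace X] (m : Measure X) (C : Set X) : Prop :=
  ∀ A : Set X, A ⊆ C → NullMeasurableSet A m → IsRecurrentSet G m A

/-- The restriction of the action to the invariant set `D` is completely dissipative: `D` is (mod 0)
the union of the translates of a wandering set. -/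
def CompletelyDissipativeOn (G : Type*) {X : Type*} [Group G] [MulAction G X]
    [MeasurableSpace X] (m : Measure X) (D : Set X) : Prop :=
  ∃ W : Set X, W ⊆ D ∧ IsWanderingSet G m W ∧ m (D \ ⋃ g : G, g • W) = 0

/-- `C` and `D` are the conservative and the dissipative part of the action: `X` is the disjoint
union of the measurable invariant sets `C` and `D`, the action on `C` is conservative, and the
action on `D` is completely dissipative. -/
structure IsHopfDecomposition (G : Type*) {X : Type*} [Group G] [MulAction G X]
    [MeasurableSpace X] (m : Measure X) (C D : Set X) : Prop where
  disjoint : Disjoint C D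
  union_eq : C ∪ D = Set.univ
  nullMeasurableSet_left : NullMeasurableSet C m
  nullMeasurableSet_right : NullMeasurableSet D m
  smul_left : ∀ g : G, g • C = C
  smul_right : ∀ g : G, g • D = D
  conservative : ConservativeOn G m C
  completelyDissipative : CompletelyDissipativeOn G m D

/-- The `σ`-algebra of (mod 0) `G`-invariant measurable sets. -/
@[reducible]
def invariantSets (G : Type*) {X : Type*} [Group G] [MulAction G X]
    [MeasurableSpace X] (m : Measure X) : MeasurableSpace X where
  MeasurableSet' s := MeasurableSet s ∧ ∀ g : G, (fun x : X => g • x) ⁻¹' s =ᵐ[m] s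
  measurableSet_empty := ⟨MeasurableSet.empty, fun _ => Filter.EventuallyEq.rfl⟩
  measurableSet_compl := fun _ hs => ⟨hs.1.compl, fun g => (hs.2 g).compl⟩
  measurableSet_iUnion := fun s hs => ⟨MeasurableSet.iUnion fun n => (hs n).1, fun g => by
    rw [Set.preimage_iUnion]
    exact Filter.EventuallyEq.countable_iUnion fun n => (hs n).2 g⟩

/-- The conditional measure of `m` on the ergodic component containing `x`, i.e. the conditional
measure with respect to the `σ`-algebra of invariant sets. -/
noncomputable def ergodicComponent (G : Type*) {X : Type*} [Group G] [MulAction G X]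
    [MeasurableSpace X] [StandardBorelSpace X] (m : Measure X) [IsFiniteMeasure m] (x : X) :
    Measure X :=
  condExpKernel m (invariantSets G m) x

/-- A measure is purely atomic if almost every point is an atom. -/
def IsPurelyAtomic {X : Type*} [MeasurableSpace X] (ν : Measure X) : Prop :=
  ∀ᵐ y ∂ν, ν {y} ≠ 0

/-- The discontinual part of the action: the union of the purely atomic ergodic components. -/
def discontinualPart (G : Type*) {X : Type*} [Group G] [MulAction G X]
    [MeasurableSpace X] [StandardBorelSpace X] (m : Measure X) [IsFiniteMeasure m] : Set X :=
  {x | IsPurelyAtomic (ergodicComponent G m x)}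

/-- The measure `μ_x` on the orbit `Gx`, with the weight `(d g⁻¹m / dm)(x)` at the point `gx`, where
`g⁻¹m` is the image of `m` under `g⁻¹`. If the stabilizer of `x` is trivial, then every point of the
orbit is `gx` for exactly one `g`. -/
noncomputable def orbitMeasure (G : Type*) {X : Type*} [Group G] [MulAction G X]
    [MeasurableSpace X] (m : Measure X) (x : X) : Measure (MulAction.orbit G x) :=
  Measure.sum fun g : G =>
    (m.map (fun y : X => g⁻¹ • y)).rnDeriv m x • Measure.dirac ⟨g • x, MulAction.mem_orbit x g⟩

/-- The set `M_x` of the atoms of maximal weight of the measure `μ_x`. -/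
def maximalAtoms (G : Type*) {X : Type*} [Group G] [MulAction G X]
    [MeasurableSpace X] (m : Measure X) (x : X) : Set (MulAction.orbit G x) :=
  {y | orbitMeasure G m x {y} ≠ 0 ∧ ∀ z, orbitMeasure G m x {z} ≤ orbitMeasure G m x {y}}

/-! Write w(g, x) for `orbitWeight m g x`. Off a null set w is a positive finite cocycle, so passing
from x to gx divides all weights on the orbit by w(g, x). Finiteness of the total weight and the
location of the heaviest points thus depend on the orbit only. Over a wandering set W the integral
of ∑ w(g, x) is at most ∑ m(gW) ≤ m(X), so dissipative orbits have finite total weight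
(`ae_tsum_orbitWeight_ne_top`). Finite total weight leaves finitely many weights above each level,
hence a non-empty finite set of heaviest points. Conversely, in the conservative part almost every
point of a measurable set returns to it infinitely often (`ae_infinite_setOf_smul_mem`). Applied to
the set of heaviest points, this excludes a non-empty finite `maximalAtoms`. Applied to the points
of mass at least 1/(n+1) in their ergodic component, it excludes atoms, because the masses along an
orbit have sum at most 1. In the dissipative part the invariant sets separate the points of W, so a
component lives on a single countable orbit. -/

/-- The Radon–Nikodym cocycle `(d g⁻¹m / dm)(x)` of an action. -/
noncomputable def orbitWeight {G X : Type*} [Group G] [MulAction G X]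
    [MeasurableSpace X] (m : Measure X) (g : G) : X → ℝ≥0∞ :=
  (m.map (fun y : X => g⁻¹ • y)).rnDeriv m

/-- A point with trivial stabilizer on whose orbit `orbitWeight` is a normalized cocycle. -/
structure IsRegularPoint (G : Type*) {X : Type*} [Group G] [MulAction G X]
    [MeasurableSpace X] (m : Measure X) (x : X) : Prop where
  free : ∀ g : G, g • x = x → g = 1
  weight_one : orbitWeight m (1 : G) x = 1
  cocycle : ∀ g h : G, orbitWeight m h (g • x) * orbitWeight m g x = orbitWeight m (h * g) x

/-! ### The Radon–Nikodym cocycle and recurrence. -/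

section Action

variable {G X : Type*} [Group G] [MulAction G X] [MeasurableSpace X] {m : Measure X}

theorem measurable_orbitWeight (g : G) : Measurable (orbitWeight (X := X) m g) :=
  Measure.measurable_rnDeriv _ _

namespace MeasureClassPreservingAction

theorem ae_smul (hact : MeasureClassPreservingAction G m) {p : X → Prop}
    (hp : ∀ᵐ x ∂m, p x) (g : G) : ∀ᵐ x ∂m, p (g • x) :=
  ae_of_ae_map (hact.aemeasurable g) ((hact.map_absolutelyContinuous g).ae_le hp)

theorem ae_forall_smul [Countable G] (hact : MeasureClassPreservingAction G m) {p : X → Prop}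
    (hp : ∀ᵐ x ∂m, p x) : ∀ᵐ x ∂m, ∀ g : G, p (g • x) :=
  ae_all_iff.2 (hact.ae_smul hp)

theorem nullMeasurableSet_preimage (hact : MeasureClassPreservingAction G m) {s : Set X}
    (hs : NullMeasurableSet s m) (g : G) : NullMeasurableSet ((fun x : X => g • x) ⁻¹' s) m :=
  ((hact.aemeasurable g).nullMeasurable (measurableSet_toMeasurable m s)).congr
    (hact.ae_smul hs.toMeasurable_ae_eq.mem_iff g |>.mono fun _ hx => propext hx)

theorem nullMeasurableSet_setOf_finite [Countable G] (hact : MeasureClassPreservingAction G m)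
    {B : Set X} (hB : NullMeasurableSet B m) :
    NullMeasurableSet {x | {g : G | g • x ∈ B}.Finite} m := by
  have h : {x | {g : G | g • x ∈ B}.Finite} =
      ⋃ F : Finset G, ⋂ g : {g : G // g ∉ F}, ((fun x : X => (g : G) • x) ⁻¹' B)ᶜ := by
    ext x
    simp only [Set.mem_ofPred_eq, Set.mem_iUnion, Set.mem_iInter, Set.mem_compl_iff,
      Set.mem_preimage, Subtype.forall]
    constructor
    · intro hx
      exact ⟨hx.toFinset, fun g hg => by simpa using hg⟩
    · rintro ⟨F, hF⟩
      exact F.finite_toSet.subset fun g hg => by_contra fun hgF => hF g hgF hg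
  rw [h]
  exact .iUnion fun F => .iInter fun g => (hact.nullMeasurableSet_preimage hB g).compl

theorem lintegral_mul_orbitWeight [IsFiniteMeasure m]
    (hact : MeasureClassPreservingAction G m) {F : X → ℝ≥0∞} (hF : AEMeasurable F m) (g : G) :
    ∫⁻ x, F x * orbitWeight m g x ∂m = ∫⁻ x, F (g⁻¹ • x) ∂m := by
  have hd : m.withDensity (orbitWeight m g) = m.map (fun y : X => g⁻¹ • y) :=
    Measure.withDensity_rnDeriv_eq _ _ (hact.map_absolutelyContinuous g⁻¹)
  rw [← lintegral_map' (hF.mono_ac (hact.map_absolutelyContinuous g⁻¹)) (hact.aemeasurable g⁻¹),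
    ← hd, lintegral_withDensity_eq_lintegral_mul₀ (measurable_orbitWeight g).aemeasurable hF]
  simp only [Pi.mul_apply, mul_comm]

/-- Both sides are densities of the same measure: changing variables by g and then by h agrees with
changing variables by hg. -/
theorem ae_orbitWeight_cocycle [IsFiniteMeasure m] (hact : MeasureClassPreservingAction G m)
    (g h : G) :
    ∀ᵐ x ∂m, orbitWeight m h (g • x) * orbitWeight m g x = orbitWeight m (h * g) x := by
  have hm : AEMeasurable (fun x : X => orbitWeight m h (g • x)) m :=
    (measurable_orbitWeight h).comp_aemeasurable (hact.aemeasurable g)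
  refine ae_eq_of_forall_setLIntegral_eq_of_sigmaFinite₀
    (hm.mul (measurable_orbitWeight g).aemeasurable)
    (measurable_orbitWeight (h * g)).aemeasurable fun s hs _ => ?_
  have hi : AEMeasurable (s.indicator (1 : X → ℝ≥0∞)) m :=
    (measurable_one.indicator hs).aemeasurable
  have key (F : X → ℝ≥0∞) : ∫⁻ x in s, F x ∂m = ∫⁻ x, s.indicator 1 x * F x ∂m := by
    rw [← lintegral_indicator hs]
    congr with x
    by_cases hx : x ∈ s <;> simp [hx]
  have h1 := hact.lintegral_mul_orbitWeight (hi.mul hm) g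
  have h2 := hact.lintegral_mul_orbitWeight
    ((hi.mono_ac (hact.map_absolutelyContinuous g⁻¹)).comp_aemeasurable (hact.aemeasurable g⁻¹)) h
  rw [key, key, hact.lintegral_mul_orbitWeight hi]
  simp only [Pi.mul_apply, smul_inv_smul, mul_assoc] at h1
  rw [h1]
  refine h2.trans ?_
  simp only [mul_inv_rev, mul_smul, Function.comp_apply]

theorem ae_isRegularPoint [Countable G] [IsFiniteMeasure m]
    (hact : MeasureClassPreservingAction G m) (hfree : FreeAction G m) :
    ∀ᵐ x ∂m, IsRegularPoint G m x := by
  have h1 : ∀ᵐ x ∂m, orbitWeight m (1 : G) x = 1 := by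
    have := Measure.rnDeriv_self m
    simpa [orbitWeight, Filter.EventuallyEq] using this
  have h2 : ∀ᵐ x ∂m, ∀ g h : G,
      orbitWeight m h (g • x) * orbitWeight m g x = orbitWeight m (h * g) x :=
    ae_all_iff.2 fun g => ae_all_iff.2 fun h => hact.ae_orbitWeight_cocycle g h
  filter_upwards [hfree, h1, h2] with x a b c using ⟨a, b, c⟩

theorem ae_tsum_orbitWeight_ne_top [Countable G] [IsFiniteMeasure m]
    (hact : MeasureClassPreservingAction G m) {W : Set X} (hW : IsWanderingSet G m W) :
    ∀ᵐ x ∂m, x ∈ W → ∑' g : G, orbitWeight m g x ≠ ∞ := by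
  rw [← ae_restrict_iff'₀ hW.1]
  have hint : ∫⁻ x in W, ∑' g : G, orbitWeight m g x ∂m ≠ ∞ := by
    rw [lintegral_tsum fun g => (measurable_orbitWeight g).aemeasurable]
    refine ne_top_of_le_ne_top (measure_ne_top m (⋃ g : G, g • W)) ?_
    have hpre (g : G) : (fun x : X => g⁻¹ • x) ⁻¹' W = g • W := Set.preimage_smul_inv g W
    refine le_trans (ENNReal.tsum_le_tsum fun g => ?_)
      (tsum_meas_le_meas_iUnion_of_disjoint₀ m (fun g => ?_) fun g h hgh =>
        (hW.2 g h hgh).aedisjoint)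
    · refine (Measure.setLIntegral_rnDeriv_le W).trans_eq ?_
      rw [Measure.map_apply₀ (hact.aemeasurable g⁻¹)
        (hW.1.mono_ac (hact.map_absolutelyContinuous g⁻¹)), hpre]
    · rw [← hpre]
      exact hact.nullMeasurableSet_preimage hW.1 g⁻¹
  filter_upwards [ae_lt_top (Measurable.tsum fun g => measurable_orbitWeight g) hint]
    with x hx using hx.ne

/-- If the returns to B were finite in number, a Borel injection f into ℝ would single out the one
with least f. By freeness the selected points `W` never return to `W`, so conservativity makes `W`
null, and then almost every orbit misses it. -/
theorem ae_infinite_setOf_smul_mem [Countable G] [StandardBorelSpace X]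
    (hact : MeasureClassPreservingAction G m) (hfree : FreeAction G m) {C B : Set X}
    (hC : ConservativeOn G m C) (hBC : B ⊆ C) (hB : NullMeasurableSet B m) :
    ∀ᵐ x ∂m, x ∈ B → {g : G | g • x ∈ B}.Infinite := by
  let f := embeddingReal X
  have hf : Measurable f := measurable_embeddingReal X
  have hfi : f.Injective := (measurableEmbedding_embeddingReal X).injective
  let W : Set X := (B ∩ {x | {g : G | g • x ∈ B}.Finite}) ∩
    ⋂ g : G, (((fun x => g • x) ⁻¹' B)ᶜ ∪ {x | f x ≤ f (g • x)})
  have hW : NullMeasurableSet W m :=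
    (hB.inter (hact.nullMeasurableSet_setOf_finite hB)).inter <| .iInter fun g =>
      (hact.nullMeasurableSet_preimage hB g).compl.union
        (nullMeasurableSet_le hf.aemeasurable (hf.comp_aemeasurable (hact.aemeasurable g)))
  have hWmem {x : X} : x ∈ W ↔ (x ∈ B ∧ {g : G | g • x ∈ B}.Finite) ∧
      ∀ g : G, g • x ∈ B → f x ≤ f (g • x) := by
    simp [W, imp_iff_not_or]
  have hW0 : ∀ᵐ x ∂m, x ∉ W := by
    filter_upwards [(hC W (fun x hx => hBC hx.1.1) hW).2, hfree] with x hx hfr hxW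
    obtain ⟨g, hg, hgW⟩ := hx hxW
    have h1 := (hWmem.1 hxW).2 g hgW.1.1
    have h2 := (hWmem.1 hgW).2 g⁻¹ (by simpa using hxW.1.1)
    rw [inv_smul_smul] at h2
    exact hg (hfr g (hfi (h2.antisymm h1)))
  filter_upwards [hact.ae_forall_smul hW0] with x hx hxB hfin
  obtain ⟨g, hg, hmin⟩ := Set.exists_min_image _ (fun g : G => f (g • x)) hfin ⟨1, by simpa⟩
  refine hx g (hWmem.2 ⟨⟨hg, ?_⟩, fun h hh => ?_⟩)
  · refine (hfin.image fun k => k * g⁻¹).subset fun h hh => ⟨h * g, ?_, by simp⟩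
    simpa [mul_smul] using hh
  · simpa [mul_smul] using hmin (h * g) (by simpa [mul_smul] using hh)

end MeasureClassPreservingAction

namespace IsRegularPoint

variable {x : X}

theorem orbitWeight_inv_mul (hx : IsRegularPoint G m x) (g : G) :
    orbitWeight m g⁻¹ (g • x) * orbitWeight m g x = 1 := by
  rw [hx.cocycle, inv_mul_cancel, hx.weight_one]

theorem orbitWeight_ne_zero (hx : IsRegularPoint G m x) (g : G) : orbitWeight m g x ≠ 0 := by
  intro h
  simpa [h] using hx.orbitWeight_inv_mul g

theorem orbitWeight_ne_top (hx : IsRegularPoint G m x) (g : G) : orbitWeight m g x ≠ ∞ := by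
  intro h
  have := hx.orbitWeight_inv_mul g
  rw [h, ENNReal.mul_top'] at this
  split_ifs at this <;> simp at this

theorem orbitWeight_smul (hx : IsRegularPoint G m x) (g h : G) :
    orbitWeight m h (g • x) = orbitWeight m (h * g) x / orbitWeight m g x := by
  rw [← hx.cocycle, ENNReal.mul_div_cancel_right (hx.orbitWeight_ne_zero g)
    (hx.orbitWeight_ne_top g)]

/-- This makes sets cut out by regularity invariant exactly, not just mod 0, as a Hopf decomposition
demands. -/
theorem smul (hx : IsRegularPoint G m x) (g : G) : IsRegularPoint G m (g • x) where
  free h hh := by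
    have := hx.free (g⁻¹ * h * g) (by rw [mul_smul, mul_smul, hh, inv_smul_smul])
    rw [mul_assoc, inv_mul_eq_one] at this
    simpa using this
  weight_one := by
    rw [hx.orbitWeight_smul, one_mul,
      ENNReal.div_self (hx.orbitWeight_ne_zero g) (hx.orbitWeight_ne_top g)]
  cocycle k h := by
    rw [← mul_smul, hx.orbitWeight_smul, hx.orbitWeight_smul, hx.orbitWeight_smul,
      ← mul_assoc, div_eq_mul_inv, div_eq_mul_inv, div_eq_mul_inv, mul_assoc,
      ← mul_assoc _ (orbitWeight m (k * g) x),
      ENNReal.inv_mul_cancel (hx.orbitWeight_ne_zero _) (hx.orbitWeight_ne_top _), one_mul]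

theorem smul_injective (hx : IsRegularPoint G m x) : Function.Injective fun g : G => g • x := by
  intro g h hgh
  have := hx.free (h⁻¹ * g) (by simp only at hgh; rw [mul_smul, hgh, inv_smul_smul])
  exact (inv_mul_eq_one.1 this).symm

/-- Being heaviest on the orbit becomes a condition on the point gx alone, hence defines a
measurable subset of X. -/
theorem forall_orbitWeight_smul_le_one_iff (hx : IsRegularPoint G m x) (g : G) :
    (∀ h : G, orbitWeight m h (g • x) ≤ 1) ↔ ∀ k : G, orbitWeight m k x ≤ orbitWeight m g x := by
  have key (h : G) : orbitWeight m h (g • x) ≤ 1 ↔ orbitWeight m (h * g) x ≤ orbitWeight m g x := by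
    rw [hx.orbitWeight_smul,
      ENNReal.div_le_iff (hx.orbitWeight_ne_zero g) (hx.orbitWeight_ne_top g), one_mul]
  simp only [key]
  exact ⟨fun H k => by simpa using H (k * g⁻¹), fun H h => H _⟩

theorem tsum_orbitWeight_smul (hx : IsRegularPoint G m x) (g : G) :
    ∑' h : G, orbitWeight m h (g • x) = (∑' h : G, orbitWeight m h x) / orbitWeight m g x := by
  simp only [hx.orbitWeight_smul, div_eq_mul_inv, ENNReal.tsum_mul_right]
  congr 1
  exact (Equiv.mulRight g).tsum_eq fun h : G => orbitWeight m h x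

theorem tsum_orbitWeight_smul_ne_top_iff (hx : IsRegularPoint G m x) (g : G) :
    ∑' h : G, orbitWeight m h (g • x) ≠ ∞ ↔ ∑' h : G, orbitWeight m h x ≠ ∞ := by
  rw [hx.tsum_orbitWeight_smul, Ne, ENNReal.div_eq_top]
  simp [hx.orbitWeight_ne_zero, hx.orbitWeight_ne_top]

/-- The identity has weight 1, so weights below 1 cannot compete for the maximum. -/
theorem exists_forall_orbitWeight_le (hx : IsRegularPoint G m x)
    (hfin : {g : G | 1 ≤ orbitWeight m g x}.Finite) :
    {g : G | ∀ k : G, orbitWeight m k x ≤ orbitWeight m g x}.Nonempty ∧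
      {g : G | ∀ k : G, orbitWeight m k x ≤ orbitWeight m g x}.Finite := by
  obtain ⟨g, hg, hmax⟩ := Set.exists_max_image _ (fun g : G => orbitWeight m g x) hfin
    ⟨1, hx.weight_one.ge⟩
  refine ⟨⟨g, fun k => ?_⟩, hfin.subset fun g hg => hx.weight_one.symm.trans_le (hg 1)⟩
  rcases le_total 1 (orbitWeight m k x) with hk | hk
  exacts [hmax k hk, hk.trans hg]

end IsRegularPoint

end Action

theorem isPurelyAtomic_of_countable {X : Type*} [MeasurableSpace X] {ν : Measure X} {s : Set X}
    (hs : s.Countable) (h : ∀ᵐ y ∂ν, y ∈ s) : IsPurelyAtomic ν := by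
  have h0 : ν (⋃ y ∈ {y ∈ s | ν {y} = 0}, {y}) = 0 :=
    (measure_biUnion_null_iff (hs.mono (Set.sep_subset _ _))).2 fun y hy => hy.2
  rw [Set.biUnion_of_singleton] at h0
  filter_upwards [h, measure_eq_zero_iff_ae_notMem.1 h0] with y hy hy' h' using hy' ⟨hy, h'⟩

/-! ### Joint measurability of atoms of a kernel. -/

section Kernel

variable {α X : Type*} [MeasurableSpace α] [MeasurableSpace X] [StandardBorelSpace X]

theorem measurable_kernel_singleton (κ : Kernel α X) [IsSFiniteKernel κ] :
    Measurable fun p : α × X => κ p.1 {p.2} := by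
  have h : MeasurableSet {q : (α × X) × X | q.2 = q.1.2} :=
    measurableSet_eq_fun measurable_snd measurable_fst.snd
  simpa using Kernel.measurable_kernel_prodMk_left (κ := κ.prodMkRight X) h

theorem measurableSet_setOf_isPurelyAtomic (κ : Kernel α X) [IsSFiniteKernel κ] :
    MeasurableSet {a | IsPurelyAtomic (κ a)} := by
  have h : MeasurableSet {p : α × X | κ p.1 {p.2} = 0} :=
    measurable_kernel_singleton κ (measurableSet_singleton 0)
  have := Kernel.measurable_kernel_prodMk_left (κ := κ) h (measurableSet_singleton 0)
  convert this using 1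
  ext a
  simp [IsPurelyAtomic, ae_iff]

theorem measurableSet_setOf_isPurelyAtomic_imp (κ : Kernel α X) [IsSFiniteKernel κ] :
    MeasurableSet {p : α × X | IsPurelyAtomic (κ p.1) → κ p.1 {p.2} ≠ 0} := by
  have h1 : MeasurableSet {p : α × X | IsPurelyAtomic (κ p.1)} :=
    measurable_fst (measurableSet_setOf_isPurelyAtomic κ)
  exact h1.imp (measurable_kernel_singleton κ (measurableSet_singleton 0)).compl

end Kernel

/-! ### Invariant sets and the diagonal. -/

section InvariantSets

variable {G X : Type*} [Group G] [MulAction G X] [MeasurableSpace X] {m : Measure X}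

theorem invariantSets_le (m : Measure X) : invariantSets G m ≤ ‹MeasurableSpace X› :=
  fun _ hs => hs.1

theorem ae_comp_smul_eq_of_measurable_invariantSets [Countable G] {φ : X → ℝ≥0∞}
    (hφ : Measurable[invariantSets G m] φ) : ∀ᵐ x ∂m, ∀ g : G, φ (g • x) = φ x :=
  ae_all_iff.2 fun g => Filter.EventuallyEq.of_forall_separating_preimage MeasurableSet
    (f := fun x => φ (g • x)) (g := φ) fun _ hU => (hφ hU).2 g

theorem exists_measurableSet_invariantSets {s : Set X}
    (hact : MeasureClassPreservingAction G m) (hs : NullMeasurableSet s m)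
    (hinv : ∀ g : G, (fun x : X => g • x) ⁻¹' s = s) :
    ∃ t, MeasurableSet[invariantSets G m] t ∧ t =ᵐ[m] s := by
  refine ⟨toMeasurable m s, ⟨measurableSet_toMeasurable m s, fun g => ?_⟩, hs.toMeasurable_ae_eq⟩
  have h1 : (fun x : X => g • x) ⁻¹' toMeasurable m s =ᵐ[m] (fun x : X => g • x) ⁻¹' s :=
    (hact.ae_smul hs.toMeasurable_ae_eq.mem_iff g).mono fun _ hx => propext hx
  rw [hinv] at h1
  exact h1.trans hs.toMeasurable_ae_eq.symm

/-- The first factor will carry `invariantSets G m`: the law of (x, x) then disintegrates over the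
ergodic components. -/
theorem measurable_diag_of_le {X : Type*} {m₁ m₂ : MeasurableSpace X} (h : m₁ ≤ m₂) :
    @Measurable X (X × X) m₂ (m₁.prod m₂) Function.diag :=
  @Measurable.prodMk X m₂ X X m₁ m₂ _ _ (measurable_id'' h) measurable_id

theorem mem_ae_map_diag_iff {X : Type*} {m₁ m₂ : MeasurableSpace X} (h : m₁ ≤ m₂)
    (μ : @Measure X m₂) {S : Set (X × X)} (hS : MeasurableSet[m₁.prod m₂] S) :
    S ∈ ae (@Measure.map X (X × X) m₂ (m₁.prod m₂) Function.diag μ) ↔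
      ∀ᵐ x ∂μ, (x, x) ∈ S :=
  letI : MeasurableSpace (X × X) := m₁.prod m₂
  mem_ae_map_iff (measurable_diag_of_le h).aemeasurable hS

end InvariantSets

/-! ### Ergodic components on the dissipative and conservative parts. -/

section ErgodicComponent

variable {G X : Type*} [Group G] [MulAction G X] [MeasurableSpace X] [StandardBorelSpace X]
  {m : Measure X} [IsFiniteMeasure m]

instance isProbabilityMeasure_ergodicComponent (x : X) :
    IsProbabilityMeasure (ergodicComponent G m x) :=
  inferInstanceAs (IsProbabilityMeasure (condExpKernel m (invariantSets G m) x))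

theorem ae_ae_ergodicComponent_of_ae {p : X → Prop} (hp : ∀ᵐ x ∂m, p x) :
    ∀ᵐ x ∂m, ∀ᵐ y ∂ergodicComponent G m x, p y := by
  rw [← condExpKernel_comp_trim (μ := m) (invariantSets_le (G := G) m)] at hp
  exact ae_of_ae_trim _ (Measure.ae_ae_of_ae_comp hp)

/-- The image of m under the diagonal is the product of the trimmed m with the conditional kernel,
so (x, x) may be replaced by (x, y) with y typical for the component of x. -/
theorem ae_ae_ergodicComponent_of_ae_diag {S : Set (X × X)}
    (hS : MeasurableSet[(invariantSets G m).prod ‹MeasurableSpace X›] S)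
    (h : ∀ᵐ x ∂m, (x, x) ∈ S) : ∀ᵐ x ∂m, ∀ᵐ y ∂ergodicComponent G m x, (x, y) ∈ S := by
  have hm := invariantSets_le (G := G) m
  have h2 := (mem_ae_map_diag_iff hm m hS).2 h
  rw [← compProd_trim_condExpKernel hm] at h2
  exact ae_of_ae_trim _ (Measure.ae_ae_of_ae_compProd h2)

theorem ae_diag_of_forall_ae_ergodicComponent {S : Set (X × X)}
    (hS : MeasurableSet[(invariantSets G m).prod ‹MeasurableSpace X›] S)
    (h : ∀ x, ∀ᵐ y ∂ergodicComponent G m x, (x, y) ∈ S) : ∀ᵐ x ∂m, (x, x) ∈ S := by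
  have hm := invariantSets_le (G := G) m
  refine (mem_ae_map_diag_iff hm m hS).1 ?_
  rw [← compProd_trim_condExpKernel hm]
  exact (@Measure.ae_compProd_iff X X (invariantSets G m) _ (m.trim hm)
    (condExpKernel m (invariantSets G m)) _ _ (· ∈ S) hS).2 (.of_forall h)

theorem ae_ergodicComponent_self_ne_zero :
    ∀ᵐ x ∂m, x ∈ discontinualPart G m → ergodicComponent G m x {x} ≠ 0 :=
  ae_diag_of_forall_ae_ergodicComponent (G := G)
    (@measurableSet_setOf_isPurelyAtomic_imp X X (invariantSets G m) _ _
      (condExpKernel m (invariantSets G m)) _) fun x => by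
    by_cases hx : IsPurelyAtomic (ergodicComponent G m x)
    · exact hx.mono fun y hy _ => hy
    · exact .of_forall fun y h => absurd h hx

/-- A measure is determined by its values on countably many sets, the rational intervals pulled back
from ℝ, so a single null set suffices. -/
theorem ae_ergodicComponent_smul_eq [Countable G] :
    ∀ᵐ x ∂m, ∀ g : G, ergodicComponent G m (g • x) = ergodicComponent G m x := by
  have hf := measurableEmbedding_embeddingReal X
  have h (a b : ℚ) := ae_comp_smul_eq_of_measurable_invariantSets (G := G) (m := m)
    (measurable_condExpKernel (μ := m) (m := invariantSets G m)
      (hf.measurable (measurableSet_Ioo (a := (a : ℝ)) (b := b))))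
  filter_upwards [ae_all_iff.2 fun a => ae_all_iff.2 (h a)] with x hx g
  have hmap : (ergodicComponent G m (g • x)).map (embeddingReal X) =
      (ergodicComponent G m x).map (embeddingReal X) := by
    refine Real.measure_ext_Ioo_rat fun a b => ?_
    rw [Measure.map_apply hf.measurable measurableSet_Ioo,
      Measure.map_apply hf.measurable measurableSet_Ioo]
    exact hx a b g
  rw [← hf.comap_map (ergodicComponent G m (g • x)), hmap, hf.comap_map]

/-- W meets each orbit at most once, and the invariant sets `S q` record whether f at that
representative is below q. A typical y in the component of x lies in the same `S q` as x, so both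
have the same representative and y is in the orbit of x. -/
theorem ae_mem_discontinualPart_of_completelyDissipativeOn [Countable G]
    (hact : MeasureClassPreservingAction G m) {D : Set X}
    (hD : CompletelyDissipativeOn G m D) : ∀ᵐ x ∂m, x ∈ D → x ∈ discontinualPart G m := by
  obtain ⟨W, -, hW, hD0⟩ := hD
  let f := embeddingReal X
  have hf : Measurable f := measurable_embeddingReal X
  have hfi : f.Injective := (measurableEmbedding_embeddingReal X).injective
  let S (q : ℚ) : Set X := ⋃ g : G, (fun x => g • x) ⁻¹' (W ∩ {x | f x < q})
  have hSmem {q : ℚ} {x : X} : x ∈ S q ↔ ∃ g : G, g • x ∈ W ∧ f (g • x) < q := by simp [S]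
  have hS (q : ℚ) : NullMeasurableSet (S q) m := .iUnion fun g =>
    hact.nullMeasurableSet_preimage
      (hW.1.inter (measurableSet_lt hf measurable_const).nullMeasurableSet) g
  have hSinv (q : ℚ) (g : G) : (fun x : X => g • x) ⁻¹' S q = S q := by
    ext x
    simp only [Set.mem_preimage, hSmem]
    exact ⟨fun ⟨h, hh⟩ => ⟨h * g, by simpa [mul_smul] using hh⟩,
      fun ⟨h, hh⟩ => ⟨h * g⁻¹, by simpa [mul_smul] using hh⟩⟩
  -- `S q` is only measurable mod 0; `T q` is a version in the invariant σ-algebra.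
  choose T hT hTS using fun q => exists_measurableSet_invariantSets hact (hS q) (hSinv q)
  have hTS' : ∀ᵐ x ∂m, ∀ q, x ∈ T q ↔ x ∈ S q := ae_all_iff.2 fun q => (hTS q).mem_iff
  have hdiag := ae_ae_ergodicComponent_of_ae_diag (G := G) (m := m)
    (S := ⋂ q, {p : X × X | p.1 ∈ T q ↔ p.2 ∈ T q})
    (@MeasurableSet.iInter _ _ ((invariantSets G m).prod ‹MeasurableSpace X›) _ _ fun q =>
      @MeasurableSet.iff _ ((invariantSets G m).prod ‹MeasurableSpace X›)
        (fun p => p.1 ∈ T q) (fun p => p.2 ∈ T q)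
        (@measurable_fst _ _ (invariantSets G m) _ _ (hT q))
        (@measurable_snd _ _ (invariantSets G m) _ _ (hT q).1))
    (.of_forall fun x => by simp)
  have hW1 {w : X} {g : G} (hw : w ∈ W) (hgw : g • w ∈ W) : g = 1 := by
    by_contra hg
    exact Set.disjoint_left.1 (hW.2 g 1 hg) (Set.smul_mem_smul_set hw) (by simpa using hgw)
  filter_upwards [hdiag, ae_ae_ergodicComponent_of_ae (G := G) hTS', hTS',
    measure_eq_zero_iff_ae_notMem.1 hD0] with x hx hy hxT hxD hxmem
  refine isPurelyAtomic_of_countable (s := MulAction.orbit G x) (Set.countable_range _) ?_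
  filter_upwards [hx, hy] with y hxy hyT
  have hSS (q : ℚ) : x ∈ S q ↔ y ∈ S q := by
    rw [← hxT, ← hyT]
    exact Set.mem_iInter.1 hxy q
  have hxW : ∃ g : G, g • x ∈ W := by
    by_contra! hne
    refine hxD ⟨hxmem, fun hu => ?_⟩
    obtain ⟨g, hg⟩ := Set.mem_iUnion.1 hu
    exact hne g⁻¹ (Set.mem_smul_set_iff_inv_smul_mem.1 hg)
  obtain ⟨g, hg⟩ := hxW
  have hle {u v : X} {g h : G} (hg : g • u ∈ W) (hh : h • v ∈ W)
      (huv : ∀ q, v ∈ S q → u ∈ S q) : f (g • u) ≤ f (h • v) := by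
    refine le_of_forall_gt_imp_ge_of_dense fun a ha => ?_
    obtain ⟨q, hq1, hq2⟩ := exists_rat_btwn ha
    obtain ⟨k, hk, hkq⟩ := hSmem.1 (huv q (hSmem.2 ⟨h, hh, hq1⟩))
    have : k * g⁻¹ = 1 := hW1 hg (by simpa [mul_smul] using hk)
    rw [mul_inv_eq_one] at this
    subst this
    exact (hkq.trans hq2).le
  obtain ⟨q, hq⟩ := exists_rat_gt (f (g • x))
  obtain ⟨h, hh, -⟩ := hSmem.1 ((hSS q).1 (hSmem.2 ⟨g, hg, hq⟩))
  have heq := hfi ((hle hg hh fun q => (hSS q).2).antisymm (hle hh hg fun q => (hSS q).1))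
  exact ⟨h⁻¹ * g, by simp only [mul_smul, heq, inv_smul_smul]⟩

/-- The component is constant along the orbit and has finite mass, so only finitely many points of
the orbit have mass at least 1/(n+1). Infinite recurrence to `B n` forbids even one. -/
theorem ae_notMem_discontinualPart_of_conservativeOn [Countable G]
    (hact : MeasureClassPreservingAction G m) (hfree : FreeAction G m) {C : Set X}
    (hCm : NullMeasurableSet C m) (hC : ConservativeOn G m C) :
    ∀ᵐ x ∂m, x ∈ C → x ∉ discontinualPart G m := by
  let a (x : X) : ℝ≥0∞ := ergodicComponent G m x {x}
  have ha : Measurable a := by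
    have h := @measurable_kernel_singleton X X (invariantSets G m) _ _
      (condExpKernel m (invariantSets G m)) _
    exact h.comp (measurable_diag_of_le (invariantSets_le (G := G) m))
  let B (n : ℕ) : Set X := C ∩ {x | ((n : ℝ≥0∞) + 1)⁻¹ ≤ a x}
  have hB (n : ℕ) := hact.ae_infinite_setOf_smul_mem hfree hC (B := B n) Set.inter_subset_left
    (hCm.inter (measurableSet_le measurable_const ha).nullMeasurableSet)
  filter_upwards [ae_all_iff.2 hB, ae_ergodicComponent_self_ne_zero (G := G) (m := m),
    ae_ergodicComponent_smul_eq (G := G) (m := m), hfree] with x hxB hx hxinv hxfree hxC hxP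
  obtain ⟨n, hn⟩ := ENNReal.exists_inv_nat_lt (hx hxP)
  have hn' : ((n : ℝ≥0∞) + 1)⁻¹ ≤ a x := (ENNReal.inv_le_inv.2 le_self_add).trans hn.le
  refine hxB n ⟨hxC, hn'⟩ ?_
  have hinj : Function.Injective fun g : G => g • x := fun g h hgh =>
    (inv_mul_eq_one.1 (hxfree (h⁻¹ * g)
      (by simp only at hgh; rw [mul_smul, hgh, inv_smul_smul]))).symm
  have hsum : ∑' g : G, ergodicComponent G m x {g • x} ≠ ∞ :=
    ne_top_of_le_ne_top (measure_ne_top (ergodicComponent G m x) _)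
      (tsum_meas_le_meas_iUnion_of_disjoint _ (fun g => measurableSet_singleton _)
        fun g h hgh => Set.disjoint_singleton.2 (hinj.ne hgh))
  refine (ENNReal.finite_const_le_of_tsum_ne_top hsum
    (ε := ((n : ℝ≥0∞) + 1)⁻¹) (by simp)).subset fun g hg => ?_
  have h2 : ((n : ℝ≥0∞) + 1)⁻¹ ≤ a (g • x) := hg.2
  rwa [show a (g • x) = ergodicComponent G m x {g • x} by rw [← hxinv g]] at h2

end ErgodicComponent

/-! ### Orbit measures and the Hopf decomposition. -/

section HopfDecomposition

variable {G X : Type*} [Group G] [MulAction G X] [MeasurableSpace X] {m : Measure X}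

namespace IsRegularPoint

variable {x : X}

theorem injective_orbitMap (hx : IsRegularPoint G m x) :
    Function.Injective fun g : G => (⟨g • x, MulAction.mem_orbit x g⟩ : MulAction.orbit G x) :=
  fun _ _ h => hx.smul_injective (congrArg Subtype.val h)

theorem orbitMeasure_singleton [MeasurableSingletonClass X] (hx : IsRegularPoint G m x) (g : G) :
    orbitMeasure G m x {⟨g • x, MulAction.mem_orbit x g⟩} = orbitWeight m g x := by
  rw [orbitMeasure, Measure.sum_apply _ (measurableSet_singleton _), tsum_eq_single g]
  · simp [orbitWeight]
  · intro h hh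
    have : (⟨h • x, MulAction.mem_orbit x h⟩ : MulAction.orbit G x) ≠
        ⟨g • x, MulAction.mem_orbit x g⟩ := hx.injective_orbitMap.ne hh
    simp only [Measure.smul_apply, smul_eq_mul]
    rw [Measure.dirac_apply' _ (measurableSet_singleton _),
      Set.indicator_of_notMem (by simpa using this), mul_zero]

theorem maximalAtoms_eq_image [MeasurableSingletonClass X] (hx : IsRegularPoint G m x) :
    maximalAtoms G m x =
      (fun g : G => (⟨g • x, MulAction.mem_orbit x g⟩ : MulAction.orbit G x)) ''
        {g : G | ∀ k : G, orbitWeight m k x ≤ orbitWeight m g x} := by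
  ext ⟨_, g, rfl⟩
  rw [hx.injective_orbitMap.mem_set_image (s := {g : G | ∀ k : G, _}) (a := g)]
  change orbitMeasure G m x {⟨g • x, MulAction.mem_orbit x g⟩} ≠ 0 ∧
    (∀ z, orbitMeasure G m x {z} ≤ orbitMeasure G m x {⟨g • x, MulAction.mem_orbit x g⟩}) ↔ _
  rw [hx.orbitMeasure_singleton]
  constructor
  · rintro ⟨-, h⟩ k
    exact (hx.orbitMeasure_singleton k).symm.trans_le (h _)
  · refine fun h => ⟨hx.orbitWeight_ne_zero g, ?_⟩
    rintro ⟨_, k, rfl⟩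
    exact (hx.orbitMeasure_singleton k).trans_le (h k)

theorem finite_setOf_le_orbitMeasure_iff [MeasurableSingletonClass X]
    (hx : IsRegularPoint G m x) (t : ℝ≥0∞) :
    {y | t ≤ orbitMeasure G m x {y}}.Finite ↔ {g : G | t ≤ orbitWeight m g x}.Finite := by
  have : {y | t ≤ orbitMeasure G m x {y}} =
      (fun g : G => (⟨g • x, MulAction.mem_orbit x g⟩ : MulAction.orbit G x)) ''
        {g : G | t ≤ orbitWeight m g x} := by
    ext ⟨_, g, rfl⟩
    rw [hx.injective_orbitMap.mem_set_image (s := {g : G | _}) (a := g)]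
    change t ≤ orbitMeasure G m x {⟨g • x, MulAction.mem_orbit x g⟩} ↔ _
    rw [hx.orbitMeasure_singleton]
    rfl
  rw [this, Set.finite_image_iff hx.injective_orbitMap.injOn]

end IsRegularPoint

theorem isFiniteMeasure_orbitMeasure_iff (x : X) :
    IsFiniteMeasure (orbitMeasure G m x) ↔ ∑' g : G, orbitWeight m g x ≠ ∞ := by
  rw [isFiniteMeasure_iff, orbitMeasure, Measure.sum_apply _ .univ, lt_top_iff_ne_top]
  simp [orbitWeight]

theorem MeasureClassPreservingAction.exists_isHopfDecomposition [Countable G]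
    [StandardBorelSpace X] [IsFiniteMeasure m]
    (hact : MeasureClassPreservingAction G m) (hfree : FreeAction G m) :
    ∃ C D : Set X, IsHopfDecomposition G m C D := by
  have hreg := hact.ae_isRegularPoint hfree
  let f := embeddingReal X
  have hf : Measurable f := measurable_embeddingReal X
  have hfi : f.Injective := (measurableEmbedding_embeddingReal X).injective
  -- Taking the finite total weight as the definition of `D` avoids an exhaustion by wandering sets.
  let D : Set X := {x | IsRegularPoint G m x ∧ ∑' g : G, orbitWeight m g x ≠ ∞}
  have hDsmul {x : X} (hx : x ∈ D) (g : G) : g • x ∈ D :=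
    ⟨hx.1.smul g, (hx.1.tsum_orbitWeight_smul_ne_top_iff g).2 hx.2⟩
  have hDinv (g : G) : g • D = D := by
    ext x
    rw [Set.mem_smul_set_iff_inv_smul_mem]
    exact ⟨fun h => by simpa using hDsmul h g, fun h => hDsmul h g⁻¹⟩
  have hDm : NullMeasurableSet D m := by
    have h1 : NullMeasurableSet {x : X | IsRegularPoint G m x} m :=
      nullMeasurableSet_univ.congr (hreg.mono fun x hx => (eq_true hx).symm)
    exact h1.inter (measurableSet_eq_fun (Measurable.tsum fun g => measurable_orbitWeight g)
      measurable_const).compl.nullMeasurableSet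
  let A : Set X := D ∩ ⋂ g : G, {x | orbitWeight m g x ≤ 1}
  have hAmem {x : X} : x ∈ A ↔ x ∈ D ∧ ∀ g : G, orbitWeight m g x ≤ 1 := by simp [A]
  have hAm : NullMeasurableSet A m := hDm.inter <| .iInter fun g =>
    (measurableSet_le (measurable_orbitWeight g) measurable_const).nullMeasurableSet
  -- Among the finitely many heaviest points of an orbit in `D`, f breaks ties, leaving exactly one.
  let W : Set X := A ∩ ⋂ g : G, (((fun x => g • x) ⁻¹' A)ᶜ ∪ {x | f x ≤ f (g • x)})
  have hWmem {x : X} : x ∈ W ↔ x ∈ A ∧ ∀ g : G, g • x ∈ A → f x ≤ f (g • x) := by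
    simp [W, imp_iff_not_or]
  have hWm : NullMeasurableSet W m := hAm.inter <| .iInter fun g =>
    (hact.nullMeasurableSet_preimage hAm g).compl.union
      (nullMeasurableSet_le hf.aemeasurable (hf.comp_aemeasurable (hact.aemeasurable g)))
  have hWwand : IsWanderingSet G m W := by
    refine ⟨hWm, fun g h hgh => Set.disjoint_left.2 ?_⟩
    rintro _ ⟨u, hu, rfl⟩ ⟨v, hv, hvu⟩
    simp only at hvu
    have hu' := hWmem.1 hu
    have hv' := hWmem.1 hv
    have e1 : (h⁻¹ * g) • u = v := by rw [mul_smul, ← hvu, inv_smul_smul]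
    have e2 : (h⁻¹ * g)⁻¹ • v = u := by rw [← e1, inv_smul_smul]
    have h1 := hu'.2 (h⁻¹ * g) (e1 ▸ hv'.1)
    have h2 := hv'.2 (h⁻¹ * g)⁻¹ (e2.symm ▸ hu'.1)
    rw [e1] at h1
    rw [e2] at h2
    have huv := hfi (h1.antisymm h2)
    exact hgh (inv_mul_eq_one.1 (hu'.1.1.1.free _ (e1.trans huv.symm))).symm
  have hcover : D ⊆ ⋃ g : G, g • W := by
    intro x hx
    have hfin : {g : G | g • x ∈ A}.Finite := by
      refine (hx.1.exists_forall_orbitWeight_le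
        (ENNReal.finite_const_le_of_tsum_ne_top hx.2 one_ne_zero)).2.subset fun g hg => ?_
      exact (hx.1.forall_orbitWeight_smul_le_one_iff g).1 (hAmem.1 hg).2
    have hne : {g : G | g • x ∈ A}.Nonempty := by
      obtain ⟨g, hg⟩ := (hx.1.exists_forall_orbitWeight_le
        (ENNReal.finite_const_le_of_tsum_ne_top hx.2 one_ne_zero)).1
      exact ⟨g, hAmem.2 ⟨hDsmul hx g, (hx.1.forall_orbitWeight_smul_le_one_iff g).2 hg⟩⟩
    obtain ⟨g, hg, hmin⟩ := Set.exists_min_image _ (fun g : G => f (g • x)) hfin hne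
    refine Set.mem_iUnion.2 ⟨g⁻¹, Set.mem_smul_set_iff_inv_smul_mem.2 ?_⟩
    rw [inv_inv]
    refine hWmem.2 ⟨hg, fun h hh => ?_⟩
    rw [← mul_smul] at hh ⊢
    exact hmin _ hh
  refine ⟨Dᶜ, D, disjoint_compl_left, Set.compl_union_self D, hDm.compl, hDm, fun g => ?_, hDinv,
    fun B hB hBm => ⟨hBm, ?_⟩, W, fun x hx => hx.1.1, hWwand, ?_⟩
  · rw [Set.smul_set_compl, hDinv]
  -- The points of B that never return form a wandering set, on which the total weight is finite
  -- almost everywhere; but B avoids `D`.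
  · let B' : Set X := B ∩ ⋂ g : {g : G // g ≠ 1}, ((fun x => (g : G) • x) ⁻¹' B)ᶜ
    have hB'mem {x : X} : x ∈ B' ↔ x ∈ B ∧ ∀ g : G, g ≠ 1 → g • x ∉ B := by simp [B']
    have hB' : IsWanderingSet G m B' := by
      refine ⟨hBm.inter <| .iInter fun g => (hact.nullMeasurableSet_preimage hBm g).compl,
        fun g h hgh => Set.disjoint_left.2 ?_⟩
      rintro _ ⟨u, hu, rfl⟩ ⟨v, hv, hvu⟩
      simp only at hvu
      refine (hB'mem.1 hu).2 (h⁻¹ * g) (fun h1 => hgh (inv_mul_eq_one.1 h1).symm) ?_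
      rw [mul_smul, ← hvu, inv_smul_smul]
      exact hv.1
    filter_upwards [hact.ae_tsum_orbitWeight_ne_top hB', hreg] with x hx hxreg hxB
    by_contra! hne
    exact hB hxB ⟨hxreg, hx (hB'mem.2 ⟨hxB, hne⟩)⟩
  · rw [Set.sdiff_eq_empty.2 hcover, measure_empty]

namespace IsHopfDecomposition

variable {C D : Set X}

theorem smul_mem_left_iff (h : IsHopfDecomposition G m C D) (g : G) {x : X} :
    g • x ∈ C ↔ x ∈ C := by
  conv_lhs => rw [← h.smul_left g]
  exact Set.smul_mem_smul_set_iff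

theorem smul_mem_right_iff (h : IsHopfDecomposition G m C D) (g : G) {x : X} :
    g • x ∈ D ↔ x ∈ D := by
  conv_lhs => rw [← h.smul_right g]
  exact Set.smul_mem_smul_set_iff

theorem notMem_right_iff (h : IsHopfDecomposition G m C D) {x : X} : x ∉ D ↔ x ∈ C := by
  have : x ∈ C ∪ D := h.union_eq ▸ Set.mem_univ x
  exact ⟨this.resolve_right, fun hC => Set.disjoint_left.1 h.disjoint hC⟩

theorem ae_tsum_orbitWeight_ne_top [Countable G] [IsFiniteMeasure m]
    (h : IsHopfDecomposition G m C D) (hact : MeasureClassPreservingAction G m)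
    (hfree : FreeAction G m) : ∀ᵐ x ∂m, x ∈ D → ∑' g : G, orbitWeight m g x ≠ ∞ := by
  obtain ⟨W, -, hW, hD⟩ := h.completelyDissipative
  filter_upwards [hact.ae_forall_smul (hact.ae_tsum_orbitWeight_ne_top hW),
    hact.ae_isRegularPoint hfree, measure_eq_zero_iff_ae_notMem.1 hD] with x hx hxreg hxD hxmem
  by_contra hne
  refine hxD ⟨hxmem, fun hu => ?_⟩
  obtain ⟨g, hg⟩ := Set.mem_iUnion.1 hu
  exact (hxreg.tsum_orbitWeight_smul_ne_top_iff g⁻¹).1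
    (hx g⁻¹ (Set.mem_smul_set_iff_inv_smul_mem.1 hg)) hne

theorem ae_infinite_setOf_forall_orbitWeight_le [Countable G] [StandardBorelSpace X]
    [IsFiniteMeasure m] (h : IsHopfDecomposition G m C D)
    (hact : MeasureClassPreservingAction G m) (hfree : FreeAction G m) :
    ∀ᵐ x ∂m, x ∈ C → {g : G | ∀ k : G, orbitWeight m k x ≤ orbitWeight m g x}.Nonempty →
      {g : G | ∀ k : G, orbitWeight m k x ≤ orbitWeight m g x}.Infinite := by
  let B : Set X := C ∩ ⋂ g : G, {x | orbitWeight m g x ≤ 1}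
  have hBmem {x : X} : x ∈ B ↔ x ∈ C ∧ ∀ g : G, orbitWeight m g x ≤ 1 := by simp [B]
  have hB := hact.ae_infinite_setOf_smul_mem hfree h.conservative (B := B) Set.inter_subset_left <|
    h.nullMeasurableSet_left.inter <| .iInter fun g =>
      (measurableSet_le (measurable_orbitWeight g) measurable_const).nullMeasurableSet
  -- The point x need not be heaviest itself, so recurrence is applied at a heaviest gx.
  filter_upwards [hact.ae_forall_smul hB, hact.ae_isRegularPoint hfree] with x hx hxreg hxC hne hfin
  obtain ⟨g, hg⟩ := hne
  have hiff (g : G) : g • x ∈ B ↔ ∀ k : G, orbitWeight m k x ≤ orbitWeight m g x := by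
    rw [hBmem, hxreg.forall_orbitWeight_smul_le_one_iff g, h.smul_mem_left_iff g]
    exact and_iff_right hxC
  refine hx g ((hiff g).2 hg) ((hfin.image fun k => k * g⁻¹).subset fun k hk => ?_)
  have hk' : (k * g) • x ∈ B := by rw [mul_smul]; exact hk
  exact ⟨k * g, (hiff _).1 hk', by simp⟩

end IsHopfDecomposition

end HopfDecomposition

/-! ### The equivalence of the five conditions. -/

theorem mainTheorem2 {G X : Type*} [Group G] [Countable G] [MulAction G X]
    [MeasurableSpace X] [StandardBorelSpace X] (m : Measure X) [IsProbabilityMeasure m]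
    (hact : MeasureClassPreservingAction G m) (hfree : FreeAction G m) :
    (∃ C D : Set X, IsHopfDecomposition G m C D) ∧
    ∀ C D : Set X, IsHopfDecomposition G m C D →
      ∀ᵐ x ∂m, List.TFAE
        [MulAction.orbit G x ⊆ D,
         MulAction.orbit G x ⊆ discontinualPart G m,
         IsFiniteMeasure (orbitMeasure G m x),
         ∀ t : ℝ, 0 < t → {y | ENNReal.ofReal t ≤ orbitMeasure G m x {y}}.Finite,
         (maximalAtoms G m x).Nonempty ∧ (maximalAtoms G m x).Finite] := by
  refine ⟨hact.exists_isHopfDecomposition hfree, fun C D h => ?_⟩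
  filter_upwards [hact.ae_isRegularPoint hfree, h.ae_tsum_orbitWeight_ne_top hact hfree,
    h.ae_infinite_setOf_forall_orbitWeight_le hact hfree,
    hact.ae_forall_smul
      (ae_mem_discontinualPart_of_completelyDissipativeOn hact h.completelyDissipative),
    ae_notMem_discontinualPart_of_conservativeOn hact hfree h.nullMeasurableSet_left
      h.conservative] with x hx hsum hmax hdisc hcons
  have hself := MulAction.mem_orbit_self (M := G) x
  have horbit (hxD : x ∈ D) : MulAction.orbit G x ⊆ D := by
    rintro _ ⟨g, rfl⟩
    exact (h.smul_mem_right_iff g).2 hxD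
  rw [isFiniteMeasure_orbitMeasure_iff, hx.maximalAtoms_eq_image, Set.image_nonempty,
    Set.finite_image_iff hx.injective_orbitMap.injOn]
  simp only [hx.finite_setOf_le_orbitMeasure_iff]
  tfae_have 1 → 2 := by
    rintro hD _ ⟨g, rfl⟩
    exact hdisc g (hD ⟨g, rfl⟩)
  tfae_have 2 → 1 := fun hP => horbit <| by
    by_contra hxD
    exact hcons (h.notMem_right_iff.1 hxD) (hP hself)
  tfae_have 1 → 3 := fun hD => hsum (hD hself)
  tfae_have 3 → 4 := fun hfin t ht =>
    ENNReal.finite_const_le_of_tsum_ne_top hfin (ENNReal.ofReal_pos.2 ht).ne'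
  -- The level t = 1 suffices, since x itself has weight 1.
  tfae_have 4 → 5 := fun hfin =>
    hx.exists_forall_orbitWeight_le (by simpa using hfin 1 one_pos)
  tfae_have 5 → 1 := fun ⟨hne, hfin⟩ => horbit <| by
    by_contra hxD
    exact hmax (h.notMem_right_iff.1 hxD) hne hfin
  tfae_finish
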